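/- **Setting.** Untyped $\lambda$-terms are generated by $\Lambda ::= x \mid (\Lambda\,\Lambda) \mid \lambda x.\Lambda$ and are taken up to renaming of bound variables. Variables, abstractions and subterms are considered as *occurrences* in a term. A term is *beta-normal* if it contains no subterm of the form $(\lambda x.U)V$; it *has a beta-normal form* if it reduces to a beta-normal term in finitely many $\beta$-steps. *Generalized redexes.* The head lambda list $\lambda_l(M)$ and the set $gr(M)$ of generalized redexes of $M$ (pairs of an abstraction occurrence and an argument occurrence) are defined by $$\lambda_l(v)=\epsilon,\qquad \lambda_l(\lambda x.U)=\lambda x\cdot\lambda_l(U),\qquad \lambda_l(UV)=\begin{cases} l & \text{if }\lambda_l(U)=\lambda x\cdot l,\\ \epsilon&\text{if }\lambda_l(U)=\epsilon,\end{cases}$$ $$gr(v)=\emptyset,\qquad gr(\lambda x.U)=gr(U),\qquad gr(UV)=\begin{cases}\{(\lambda x,V)\}\cup gr(U)\cup gr(V)&\text{if }\lambda_l(U)=\lambda x\cdot l,\\ gr(U)\cup gr(V)&\text{if }\lambda_l(U)=\epsilon.\end{cases}$$ A variable occurrence is *involved* in $(\lambda x,A)\in gr(M)$ if it is bound by that occurrence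 of $\lambda x$. To *linearly fire* $(\lambda x,A)$ for such an occurrence is to replace this single occurrence by $A$, avoiding capture; everything else, including $\lambda x$ and the argument $A$, stays in place. *Leftmost linear reduction.* For a subterm $N$ of $M$, $lloc_M(N)$ is either a variable occurrence or $\bot$ (undefined): for a variable occurrence $v$, $lloc_M(v)=v$ if $v$ is involved in a generalized redex of $M$ and $lloc_M(v)=\bot$ otherwise; $lloc_M(\lambda x.U)=lloc_M(U)$; and $$lloc_M(UV)=\begin{cases}lloc_M(U)&\text{if }lloc_M(U)\ne\bot,\\ lloc_M(V)&\text{if }lloc_M(U)=\bot\text{ and }\lambda_l(U)=\epsilon,\\ \bot&\text{if }lloc_M(U)=\bot\text{ and }\lambda_l(U)\neq\epsilon.\end{cases}$$ If $lloc_M(M)=\bot$, then $M$ is in *quasi-normal form*. Otherwise $M\to_{ll}N$, where $N$ is obtained from $M$ by linearly firing, for the occurrence $lloc_M(M)$, the unique generalized redex in which it is involved. **Theorem (Completeness of leftmost linear reduction).** If an untyped term $M$ has a beta-normal form, then its leftmost linear reduction sequence $M\to_{ll}M_1\to_{ll}M_2\to_{ll}\cdots$ terminates, i.e. there is no infinite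 sequence of $\to_{ll}$-steps starting from $M$, and it reaches a quasi-normal form: there is a term $N$ in quasi-normal form with $M\to_{ll}^{*}N$. -/

import Mathlib

namespace LambdaCalculus

/-- Untyped lambda terms up to renaming of bound variables, in de Bruijn form: an occurrence of
`var n` is bound by the `n`-th enclosing abstraction (counting from `0`, innermost first); if there
are at most `n` enclosing abstractions, it is an occurrence of a free variable. -/
inductive Term : Type
  | var (n : ℕ) : Term
  | app (U V : Term) : Term
  | lam (U : Term) : Term
  deriving DecidableEq

/-- The steps of a path in the syntax tree: to the operator of an application, to the operand of an
application, to the body of an abstraction. -/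
inductive Dir : Type
  | fn : Dir
  | arg : Dir
  | body : Dir
  deriving DecidableEq

/-- Occurrences in a term are paths from the root of its syntax tree. -/
abbrev Pos : Type := List Dir

namespace Term

/-- The subterm of a term at an occurrence (`none` if there is no such occurrence). -/
def subtermAt : Term → Pos → Option Term
  | M, [] => some M
  | app U _, Dir.fn :: p => subtermAt U p
  | app _ V, Dir.arg :: p => subtermAt V p
  | lam U, Dir.body :: p => subtermAt U p
  | _, _ :: _ => none

/-- Replace the subterm at a given occurrence by `A`, literally, without adjusting the indices
of `A`. -/
def replaceAt : Term → Pos → Term → Term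
  | _, [], A => A
  | app U V, Dir.fn :: p, A => app (replaceAt U p A) V
  | app U V, Dir.arg :: p, A => app U (replaceAt V p A)
  | lam U, Dir.body :: p, A => lam (replaceAt U p A)
  | M, _ :: _, _ => M

/-- Add `k` to all the indices that are free below `c` enclosing abstractions. -/
def shift (k : ℕ) : ℕ → Term → Term
  | c, var n => if n < c then var n else var (n + k)
  | c, app U V => app (shift k c U) (shift k c V)
  | c, lam U => lam (shift k (c + 1) U)

/-! ### Beta reduction -/

/-- Capture-avoiding substitution for a beta step: under `c` abstractions, replace the index `c`
by `A` (shifted by `c`), and decrement the larger indices. -/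
def subst (A : Term) : ℕ → Term → Term
  | c, var n => if n < c then var n else if n = c then shift c 0 A else var (n - 1)
  | c, app U V => app (subst A c U) (subst A c V)
  | c, lam U => lam (subst A (c + 1) U)

/-- One step of beta reduction, of any redex `(λx. U) V` of the term. -/
inductive Beta : Term → Term → Prop
  | redex (U V : Term) : Beta (app (lam U) V) (subst V 0 U)
  | appLeft {U U' : Term} (V : Term) : Beta U U' → Beta (app U V) (app U' V)
  | appRight (U : Term) {V V' : Term} : Beta V V' → Beta (app U V) (app U V')
  | lam {U U' : Term} : Beta U U' → Beta (lam U) (lam U')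

/-- A term is beta-normal if no subterm of it is a redex. -/
def IsBetaNormal (M : Term) : Prop :=
  ∀ (p : Pos) (U V : Term), M.subtermAt p ≠ some (app (lam U) V)

/-- The term reduces, by finitely many beta steps, to a beta-normal term. -/
def HasBetaNormalForm (M : Term) : Prop :=
  ∃ N : Term, Relation.ReflTransGen Beta M N ∧ IsBetaNormal N

/-! ### Generalized redexes -/

/-- The head lambda list of a term, each abstraction being given by its occurrence. -/
def headLambdas : Term → List Pos
  | var _ => []
  | lam U => [] :: (headLambdas U).map (Dir.body :: ·)
  | app U _ =>
    match headLambdas U with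
    | [] => []
    | _ :: l => l.map (Dir.fn :: ·)

/-- The set of generalized redexes of a term: pairs of the occurrence of an abstraction and
the occurrence of its argument. -/
def genRedexes : Term → Finset (Pos × Pos)
  | var _ => ∅
  | lam U => (genRedexes U).image (fun r => (Dir.body :: r.1, Dir.body :: r.2))
  | app U V =>
    (match headLambdas U with
      | [] => ∅
      | x :: _ => {(Dir.fn :: x, [Dir.arg])}) ∪
    (genRedexes U).image (fun r => (Dir.fn :: r.1, Dir.fn :: r.2)) ∪
    (genRedexes V).image (fun r => (Dir.arg :: r.1, Dir.arg :: r.2))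

/-- The abstraction at the occurrence `q` of `M` binds the variable occurrence `p` of `M`: the index
at `p` is the number of abstractions strictly between them. -/
def Binds (M : Term) (q p : Pos) : Prop :=
  ∃ r : Pos, p = q ++ Dir.body :: r ∧ M.subtermAt p = some (var (r.count Dir.body))

instance (M : Term) (q p : Pos) : Decidable (Binds M q p) :=
  decidable_of_iff
    (∃ r ∈ p.tails, p = q ++ Dir.body :: r ∧ M.subtermAt p = some (var (r.count Dir.body)))
    ⟨fun ⟨r, _, h⟩ => ⟨r, h⟩, fun ⟨r, h⟩ => ⟨r, by
      rw [List.mem_tails, h.1]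
      exact ⟨q ++ [Dir.body], by simp⟩, h⟩⟩

/-- The variable occurrence `p` of `M` is involved in some generalized redex of `M`. -/
def Involved (M : Term) (p : Pos) : Prop :=
  ∃ r ∈ genRedexes M, Binds M r.1 p

instance (M : Term) (p : Pos) : Decidable (Involved M p) :=
  inferInstanceAs (Decidable (∃ r ∈ genRedexes M, Binds M r.1 p))

/-! ### Leftmost linear reduction -/

/-- `llocFrom M N p` is `lloc_M` of the subterm `N` of `M` that occurs at `p`; `none` is `⊥`. -/
def llocFrom (M : Term) : Term → Pos → Option Pos
  | var _, p => if Involved M p then some p else none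
  | lam U, p => llocFrom M U (p ++ [Dir.body])
  | app U V, p =>
    match llocFrom M U (p ++ [Dir.fn]) with
    | some q => some q
    | none => if headLambdas U = [] then llocFrom M V (p ++ [Dir.arg]) else none

/-- The leftmost linear variable occurrence of `M`, if it exists. -/
def lloc (M : Term) : Option Pos := llocFrom M M []

/-- `M` is in quasi-normal form: it has no leftmost linear variable occurrence. -/
def IsQuasiNormal (M : Term) : Prop := lloc M = none

/-- Linear substitution of the single variable occurrence `p` of `M` by the term `A` that occurs at
`a` in `M`. The indices of `A` are shifted by the number of abstractions that enclose `p` but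
not `a`, so that no free variable of `A` is captured. (When `a` is the argument of a generalized
redex involving `p`, all the abstractions enclosing `a` enclose `p` too.) -/
def linearSubst (M : Term) (p a : Pos) (A : Term) : Term :=
  M.replaceAt p (shift (p.count Dir.body - a.count Dir.body) 0 A)

/-- One step of leftmost linear reduction: linearly fire, for the leftmost linear variable
occurrence `p`, the generalized redex (abstraction at `q`, argument `A` at `a`) that involves it. -/
def LeftmostLinear (M N : Term) : Prop :=
  ∃ (p q a : Pos) (A : Term),
    lloc M = some p ∧ (q, a) ∈ genRedexes M ∧ Binds M q p ∧
      M.subtermAt a = some A ∧ N = linearSubst M p a A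

end Term

end LambdaCalculus

namespace LambdaCalculus

-- The termination measure is the size of a derivation in a non-idempotent intersection type system,
-- where an argument is typed once for each use. Typability pulls back along beta steps
-- (`Der.of_beta`, resting on the anti-substitution lemma `Der.of_subst`), and normal forms are
-- typable with negative contexts and a positive type (`IsBetaNormal.exists_der`), so every term
-- with a normal form has such a derivation.
--
-- A leftmost linear step keeps the context and the type and strictly shrinks the derivation
-- (`Fire.decreases`). Each axiom for the fired occurrence is replaced by a derivation of the
-- argument that is taken away from the redex: nothing is duplicated, and the axioms disappear. This
-- is strict only if the occurrence is typed at all. Polarity ensures it: the search enters an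
-- argument only when its operator has no head abstraction left and an uninvolved head variable, so
-- the operator's type is negative and demands the argument at least once, at positive types
-- (`Der.negativeAfter`).
--
-- To argue by induction on terms, the path-based step is matched with the relation `Fire`, which
-- sees a subterm through the number of arguments around it and the status of its free variables
-- (`llocFrom_eq_leftmost`, `exists_fire`).

/-- Non-idempotent intersection types: `arr L t` takes an argument once at each type in `L`. -/
inductive Ty : Type
  | base : Ty
  | arr (L : List Ty) (t : Ty) : Ty

namespace Ty

mutual
/-- The types allowed for free variables: no negative occurrence of an empty list of arguments. -/
inductive IsNegative : Ty → Prop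
  | base : IsNegative base
  | arr {L : List Ty} {t : Ty} : L ≠ [] → (∀ s ∈ L, IsPositive s) → IsNegative t →
      IsNegative (arr L t)
/-- The types allowed for terms: no negative occurrence of an empty list of arguments. -/
inductive IsPositive : Ty → Prop
  | base : IsPositive base
  | arr {L : List Ty} {t : Ty} : (∀ s ∈ L, IsNegative s) → IsPositive t → IsPositive (arr L t)
end

/-- The type left after `k` arguments is positive. -/
def PositiveAfter : ℕ → Ty → Prop
  | 0, t => IsPositive t
  | k + 1, arr _ t => PositiveAfter k t
  | _ + 1, base => False

/-- The type left after `k` arguments is negative. -/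
def NegativeAfter : ℕ → Ty → Prop
  | 0, t => IsNegative t
  | k + 1, arr _ t => NegativeAfter k t
  | _ + 1, base => False

/-- `TakeArg j L t t'`: removing the types `L` from the `j`-th argument of `t` gives `t'`. -/
inductive TakeArg : ℕ → Multiset Ty → Ty → Ty → Prop
  | zero {K K' : List Ty} {L : Multiset Ty} (t : Ty) : (K : Multiset Ty) = L + (K' : Multiset Ty) →
      TakeArg 0 L (arr K t) (arr K' t)
  | succ {j : ℕ} {L : Multiset Ty} {t t' : Ty} (K : List Ty) : TakeArg j L t t' →
      TakeArg (j + 1) L (arr K t) (arr K t')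

end Ty

-- Typing contexts

/-- A typing context gives the multiset of the types at which each variable is used. -/
abbrev Ctx : Type := ℕ → Multiset Ty

namespace Ctx

/-- The context outside an abstraction. -/
def tail (Γ : Ctx) : Ctx := fun i => Γ (i + 1)

/-- Insert `k` unused variables at index `c`. -/
def lift (k c : ℕ) (Γ : Ctx) : Ctx :=
  fun i => if i < c then Γ i else if i < c + k then 0 else Γ (i - k)

/-- Remove the variable `c`. -/
def remove (c : ℕ) (Γ : Ctx) : Ctx := fun i => if i < c then Γ i else Γ (i + 1)

/-- All the types in the context are negative. -/
def IsNegative (Γ : Ctx) : Prop := ∀ i, ∀ s ∈ Γ i, s.IsNegative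

@[simp] theorem tail_apply (Γ : Ctx) (i : ℕ) : tail Γ i = Γ (i + 1) := rfl
@[simp] theorem tail_add (Γ Δ : Ctx) : tail (Γ + Δ) = tail Γ + tail Δ := rfl

@[simp] theorem tail_single_zero (L : Multiset Ty) : tail (Pi.single 0 L) = 0 := by
  funext i; simp [tail]

@[simp] theorem tail_single_succ (i : ℕ) (L : Multiset Ty) :
    tail (Pi.single (i + 1) L) = Pi.single i L := by
  funext j; simp [tail, Pi.single_apply]

@[simp] theorem lift_zero (k c : ℕ) : lift k c 0 = 0 := by funext i; simp [lift]

@[simp] theorem lift_add (k c : ℕ) (Γ Δ : Ctx) : lift k c (Γ + Δ) = lift k c Γ + lift k c Δ := by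
  funext i; simp only [lift, Pi.add_apply]; split_ifs <;> simp

@[simp] theorem lift_zero_left (c : ℕ) (Γ : Ctx) : lift 0 c Γ = Γ := by
  funext i; simp only [lift]; split_ifs <;> first | rfl | omega

@[simp] theorem lift_succ_apply_zero (k c : ℕ) (Γ : Ctx) : lift k (c + 1) Γ 0 = Γ 0 := by
  simp [lift]

theorem lift_succ_zero_apply_zero (k : ℕ) (Γ : Ctx) : lift (k + 1) 0 Γ 0 = 0 := by simp [lift]

theorem tail_lift (k c : ℕ) (Γ : Ctx) : tail (lift k (c + 1) Γ) = lift k c (tail Γ) := by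
  funext i
  simp only [lift, tail]
  split_ifs <;> first | rfl | omega | (congr 1; omega)

theorem tail_lift_succ (k : ℕ) (Γ : Ctx) : tail (lift (k + 1) 0 Γ) = lift k 0 Γ := by
  funext i
  simp only [lift, tail]
  split_ifs <;> first | rfl | omega | (congr 1; omega)

theorem lift_single (k c i : ℕ) (L : Multiset Ty) :
    lift k c (Pi.single i L) = Pi.single (if i < c then i else i + k) L := by
  funext j
  simp only [lift, Pi.single_apply]
  split_ifs <;> first | rfl | omega

@[simp] theorem remove_zero (c : ℕ) : remove c 0 = 0 := by funext i; simp [remove]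

@[simp] theorem remove_add (c : ℕ) (Γ Δ : Ctx) : remove c (Γ + Δ) = remove c Γ + remove c Δ := by
  funext i; simp only [remove, Pi.add_apply]; split_ifs <;> rfl

@[simp] theorem remove_zero_left (Γ : Ctx) : remove 0 Γ = tail Γ := by funext i; simp [remove]

@[simp] theorem remove_succ_apply_zero (c : ℕ) (Γ : Ctx) : remove (c + 1) Γ 0 = Γ 0 := by
  simp [remove]

theorem tail_remove (c : ℕ) (Γ : Ctx) : tail (remove (c + 1) Γ) = remove c (tail Γ) := by
  funext i
  simp only [remove, tail]
  split_ifs <;> first | rfl | omega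

theorem IsNegative.add {Γ Δ : Ctx} (hΓ : Γ.IsNegative) (hΔ : Δ.IsNegative) :
    Ctx.IsNegative (Γ + Δ) := fun i s hs =>
  (Multiset.mem_add.1 hs).elim (hΓ i s) (hΔ i s)

theorem IsNegative.tail {Γ : Ctx} (hΓ : Γ.IsNegative) : Γ.tail.IsNegative := fun i => hΓ (i + 1)

theorem IsNegative.single (i : ℕ) {t : Ty} (ht : t.IsNegative) :
    Ctx.IsNegative (Pi.single i {t}) := fun j s hs => by
  rw [Pi.single_apply] at hs
  split_ifs at hs <;> simp_all

end Ctx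

-- Derivations of multisets of types

/-- Given the derivations of single types, with their sizes, the derivations of multisets. -/
inductive Many (P : ℕ → Ctx → Ty → Prop) : ℕ → Ctx → Multiset Ty → Prop
  | nil : Many P 0 0 0
  | cons {n m : ℕ} {Γ Δ : Ctx} {t : Ty} {L : Multiset Ty} :
      P n Γ t → Many P m Δ L → Many P (n + m) (Γ + Δ) (t ::ₘ L)

namespace Many

variable {P Q : ℕ → Ctx → Ty → Prop}

theorem singleton {n : ℕ} {Γ : Ctx} {t : Ty} (h : P n Γ t) : Many P n Γ {t} := by
  simpa using cons h nil

theorem add {n m : ℕ} {Γ Δ : Ctx} {K L : Multiset Ty} (h : Many P n Γ K) (h' : Many P m Δ L) :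
    Many P (n + m) (Γ + Δ) (K + L) := by
  induction h with
  | nil => simpa using h'
  | cons ht _ ih => rw [add_assoc, add_assoc, Multiset.cons_add]; exact cons ht ih

theorem cons_inv {n : ℕ} {Γ : Ctx} {t : Ty} {L : Multiset Ty} (h : Many P n Γ (t ::ₘ L)) :
    ∃ n₁ n₂ Γ₁ Γ₂, n = n₁ + n₂ ∧ Γ = Γ₁ + Γ₂ ∧ P n₁ Γ₁ t ∧ Many P n₂ Γ₂ L := by
  generalize hK : t ::ₘ L = K at h
  induction h generalizing L with
  | nil => exact absurd hK (Multiset.cons_ne_zero)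
  | @cons n m Γ Δ s K hs hK' ih =>
    rcases Multiset.cons_eq_cons.1 hK with ⟨rfl, rfl⟩ | ⟨_, K', rfl, rfl⟩
    · exact ⟨_, _, _, _, rfl, rfl, hs, hK'⟩
    · obtain ⟨n₁, n₂, Γ₁, Γ₂, rfl, rfl, h₁, h₂⟩ := ih rfl
      exact ⟨n₁, n + n₂, Γ₁, Γ + Γ₂, by omega, by abel, h₁, cons hs h₂⟩

theorem split {n : ℕ} {Γ : Ctx} {K L : Multiset Ty} (h : Many P n Γ (K + L)) :
    ∃ n₁ n₂ Γ₁ Γ₂, n = n₁ + n₂ ∧ Γ = Γ₁ + Γ₂ ∧ Many P n₁ Γ₁ K ∧ Many P n₂ Γ₂ L := by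
  induction K using Multiset.induction generalizing n Γ with
  | empty => exact ⟨0, n, 0, Γ, by simp, by simp, nil, by simpa using h⟩
  | cons t K ih =>
    rw [Multiset.cons_add] at h
    obtain ⟨n₁, n₂, Γ₁, Γ₂, rfl, rfl, h₁, h₂⟩ := h.cons_inv
    obtain ⟨m₁, m₂, Δ₁, Δ₂, rfl, rfl, h₃, h₄⟩ := ih h₂
    exact ⟨_, _, _, _, (add_assoc _ _ _).symm, (add_assoc _ _ _).symm, cons h₁ h₃, h₄⟩

theorem zero_inv {n : ℕ} {Γ : Ctx} (h : Many P n Γ 0) : n = 0 ∧ Γ = 0 := by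
  generalize hK : (0 : Multiset Ty) = K at h
  cases h with
  | nil => exact ⟨rfl, rfl⟩
  | cons => exact absurd hK.symm Multiset.cons_ne_zero

theorem of_singleton {n : ℕ} {Γ : Ctx} {t : Ty} (h : Many P n Γ {t}) : P n Γ t := by
  obtain ⟨n₁, n₂, Γ₁, Γ₂, rfl, rfl, h₁, h₂⟩ := cons_inv (L := 0) h
  obtain ⟨rfl, rfl⟩ := h₂.zero_inv
  simpa using h₁

theorem map {n : ℕ} {Γ : Ctx} {L : Multiset Ty} (h : Many P n Γ L)
    (f : Ctx → Ctx) (f0 : f 0 = 0) (fadd : ∀ Γ Δ, f (Γ + Δ) = f Γ + f Δ)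
    (hPQ : ∀ n Γ t, P n Γ t → Q n (f Γ) t) : Many Q n (f Γ) L := by
  induction h with
  | nil => rw [f0]; exact nil
  | cons ht _ ih => rw [fadd]; exact cons (hPQ _ _ _ ht) ih

theorem comap {n : ℕ} {Γ : Ctx} {L : Multiset Ty} (h : Many P n Γ L)
    (f : Ctx → Ctx) (f0 : f 0 = 0) (fadd : ∀ Γ Δ, f (Γ + Δ) = f Γ + f Δ)
    (hPQ : ∀ n Γ t, P n Γ t → ∃ Δ, Γ = f Δ ∧ Q n Δ t) : ∃ Δ, Γ = f Δ ∧ Many Q n Δ L := by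
  induction h with
  | nil => exact ⟨0, f0.symm, nil⟩
  | cons ht _ ih =>
    obtain ⟨Δ, rfl, hΔ⟩ := ih
    obtain ⟨Δ', rfl, hΔ'⟩ := hPQ _ _ _ ht
    exact ⟨_, (fadd _ _).symm, cons hΔ' hΔ⟩

theorem exists_of_imp {n : ℕ} {Γ : Ctx} {L : Multiset Ty} (h : Many P n Γ L)
    (hPQ : ∀ n Γ t, P n Γ t → ∃ n', Q n' Γ t) : ∃ n', Many Q n' Γ L := by
  induction h with
  | nil => exact ⟨0, nil⟩
  | cons ht _ ih =>
    obtain ⟨m, hm⟩ := ih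
    obtain ⟨m', hm'⟩ := hPQ _ _ _ ht
    exact ⟨_, cons hm' hm⟩

end Many

namespace Term

-- Type derivations and subject expansion

/-- `Der M n Γ t`: a derivation of size `n` of the type `t` for `M` in the context `Γ`. -/
def Der : Term → ℕ → Ctx → Ty → Prop
  | var i => fun n Γ t => n = 1 ∧ Γ = Pi.single i {t}
  | app U V => fun n Γ t => ∃ n₁ n₂ Γ₁ Γ₂ L, n = n₁ + n₂ + 1 ∧ Γ = Γ₁ + Γ₂ ∧
      Der U n₁ Γ₁ (Ty.arr L t) ∧ Many (Der V) n₂ Γ₂ (L : Multiset Ty)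
  | lam U => fun n Γ t => ∃ n' Γ' L s, n = n' + 1 ∧ Γ = Ctx.tail Γ' ∧ t = Ty.arr L s ∧
      Γ' 0 = (L : Multiset Ty) ∧ Der U n' Γ' s

theorem Der.shift {M : Term} (k c : ℕ) {n : ℕ} {Γ : Ctx} {t : Ty} (h : M.Der n Γ t) :
    (M.shift k c).Der n (Γ.lift k c) t := by
  induction M generalizing c n Γ t with
  | var i =>
    obtain ⟨rfl, rfl⟩ := h
    rw [Ctx.lift_single, Term.shift]
    split_ifs <;> exact ⟨rfl, rfl⟩
  | app U V ihU ihV =>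
    obtain ⟨n₁, n₂, Γ₁, Γ₂, L, rfl, rfl, hU, hV⟩ := h
    exact ⟨n₁, n₂, _, _, L, rfl, Ctx.lift_add _ _ _ _, ihU c hU,
      hV.map (Q := (V.shift k c).Der) _ (Ctx.lift_zero k c) (Ctx.lift_add k c) fun _ _ _ => ihV c⟩
  | lam U ih =>
    obtain ⟨n, Γ, L, s, rfl, rfl, rfl, h0, hU⟩ := h
    exact ⟨n, _, L, s, rfl, (Ctx.tail_lift _ _ _).symm, rfl, by simpa using h0, ih (c + 1) hU⟩

theorem Der.of_shift {M : Term} {k c n : ℕ} {Γ : Ctx} {t : Ty} (h : (M.shift k c).Der n Γ t) :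
    ∃ Δ : Ctx, Γ = Δ.lift k c ∧ M.Der n Δ t := by
  induction M generalizing c n Γ t with
  | var i =>
    refine ⟨Pi.single i {t}, ?_, ?_⟩
    · rw [Ctx.lift_single]
      rw [Term.shift] at h
      split_ifs at h ⊢ <;> exact h.2
    · rw [Term.shift] at h
      split_ifs at h <;> exact ⟨h.1, rfl⟩
  | app U V ihU ihV =>
    obtain ⟨n₁, n₂, Γ₁, Γ₂, L, rfl, rfl, hU, hV⟩ := h
    obtain ⟨Δ₁, rfl, hU'⟩ := ihU hU
    obtain ⟨Δ₂, rfl, hV'⟩ := hV.comap (Q := V.Der) _ (Ctx.lift_zero k c)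
      (Ctx.lift_add k c) fun _ _ _ => ihV
    exact ⟨_, (Ctx.lift_add _ _ _ _).symm, _, _, _, _, L, rfl, rfl, hU', hV'⟩
  | lam U ih =>
    obtain ⟨n, Γ, L, s, rfl, rfl, rfl, h0, hU⟩ := h
    obtain ⟨Δ, rfl, hU'⟩ := ih hU
    exact ⟨_, Ctx.tail_lift _ _ _, _, _, L, s, rfl, rfl, rfl, by simpa using h0, hU'⟩

/-- Anti-substitution: cut the derivation at the copies of `V` and put axioms for the variable `c`
there. The multiset `Γ₁ c` records the types of these copies; it is empty when no copy is typed.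
Sizes are not tracked, since expansion only needs existence. -/
theorem Der.of_subst {U V : Term} {c n : ℕ} {Γ : Ctx} {t : Ty} (h : (subst V c U).Der n Γ t) :
    ∃ n₁ Γ₁ n₂ Δ, U.Der n₁ Γ₁ t ∧ Many V.Der n₂ Δ (Γ₁ c) ∧
      Γ = Ctx.remove c Γ₁ + Ctx.lift c 0 Δ := by
  induction U generalizing c n Γ t with
  | var i =>
    rw [subst] at h
    refine ⟨1, Pi.single i {t}, ?_⟩
    split_ifs at h with h₁ h₂
    · refine ⟨0, 0, ⟨rfl, rfl⟩, ?_, ?_⟩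
      · rw [Pi.single_eq_of_ne (by omega)]; exact .nil
      · rw [h.2]
        funext j
        simp only [Ctx.remove, Ctx.lift_zero, add_zero, Pi.single_apply]
        split_ifs <;> first | rfl | omega
    · subst h₂
      obtain ⟨Δ, rfl, h'⟩ := h.of_shift
      refine ⟨n, Δ, ⟨rfl, rfl⟩, ?_, ?_⟩
      · rw [Pi.single_eq_same]; exact .singleton h'
      · have : Ctx.remove i (Pi.single i {t}) = 0 := by
          funext j
          simp only [Ctx.remove, Pi.single_apply, Pi.zero_apply]
          split_ifs <;> first | rfl | omega
        rw [this, zero_add]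
    · refine ⟨0, 0, ⟨rfl, rfl⟩, ?_, ?_⟩
      · rw [Pi.single_eq_of_ne (by omega)]; exact .nil
      · rw [h.2]
        funext j
        simp only [Ctx.remove, Ctx.lift_zero, add_zero, Pi.single_apply]
        split_ifs <;> first | rfl | omega
  | app U W ihU ihW =>
    obtain ⟨n₁, n₂, Γ₁, Γ₂, L, rfl, rfl, hU, hW⟩ := h
    obtain ⟨m₁, Γ₁, m₂, Δ₁, hU', hV, rfl⟩ := ihU hU
    -- The operand is typed once per element of `L`; anti-substitution is applied to each of these
    -- derivations and the results are added up.
    have key : ∃ n₁ Γ₁ n₂ Δ, Many W.Der n₁ Γ₁ L ∧ Many V.Der n₂ Δ (Γ₁ c) ∧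
        Γ₂ = Ctx.remove c Γ₁ + Ctx.lift c 0 Δ := by
      clear hU
      generalize (L : Multiset Ty) = L at hW
      induction hW with
      | nil => exact ⟨0, 0, 0, 0, .nil, .nil, by simp⟩
      | cons ht _ ih =>
        obtain ⟨k₁, Θ₁, k₂, Ξ₁, h₁, h₂, rfl⟩ := ih
        obtain ⟨l₁, Θ₂, l₂, Ξ₂, h₃, h₄, rfl⟩ := ihW ht
        exact ⟨_, _, _, _, .cons h₃ h₁, h₄.add h₂, by simp; abel⟩
    obtain ⟨k₁, Θ, k₂, Ξ, hW', hV', rfl⟩ := key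
    exact ⟨_, _, _, _, ⟨_, _, _, _, L, rfl, rfl, hU', hW'⟩, hV.add hV', by simp; abel⟩
  | lam U ih =>
    obtain ⟨n, Γ, L, s, rfl, rfl, rfl, h0, hU⟩ := h
    obtain ⟨n₁, Γ₁, n₂, Δ, hU', hV, rfl⟩ := ih hU
    refine ⟨_, _, n₂, Δ, ⟨n₁, Γ₁, L, s, rfl, rfl, rfl, ?_, hU'⟩, hV, ?_⟩
    · simpa [Ctx.lift_succ_zero_apply_zero] using h0
    · rw [Ctx.tail_add, Ctx.tail_remove, Ctx.tail_lift_succ]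

theorem Der.of_beta {M N : Term} (hMN : Beta M N) {n : ℕ} {Γ : Ctx} {t : Ty} (h : N.Der n Γ t) :
    ∃ n', M.Der n' Γ t := by
  induction hMN generalizing n Γ t with
  | redex U V =>
    obtain ⟨n₁, Γ₁, n₂, Δ, hU, hV, rfl⟩ := h.of_subst
    exact ⟨_, _, n₂, _, Δ, (Γ₁ 0).toList, rfl, by simp,
      ⟨_, Γ₁, _, _, rfl, rfl, rfl, (Multiset.coe_toList _).symm, hU⟩,
      by rwa [Multiset.coe_toList]⟩
  | appLeft V _ ih =>
    obtain ⟨n₁, n₂, Γ₁, Γ₂, L, rfl, rfl, hU, hV⟩ := h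
    obtain ⟨n', hU⟩ := ih hU
    exact ⟨_, n', _, _, _, L, rfl, rfl, hU, hV⟩
  | @appRight U V _ _ ih =>
    obtain ⟨n₁, n₂, Γ₁, Γ₂, L, rfl, rfl, hU, hV⟩ := h
    obtain ⟨n', hV⟩ := hV.exists_of_imp (Q := V.Der) fun _ _ _ => ih
    exact ⟨_, _, n', _, _, L, rfl, rfl, hU, hV⟩
  | lam _ ih =>
    obtain ⟨n, Γ, L, s, rfl, rfl, rfl, h0, hU⟩ := h
    obtain ⟨n', hU⟩ := ih hU
    exact ⟨_, n', Γ, L, s, rfl, rfl, rfl, h0, hU⟩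

-- Typability of terms with a normal form

/-- The second half strengthens the induction: a normal non-abstraction is headed by a variable,
whose type can be chosen so that the whole has any prescribed negative type. -/
theorem IsBetaNormal.exists_der {M : Term} (hM : M.IsBetaNormal) :
    (∃ n Γ t, M.Der n Γ t ∧ Γ.IsNegative ∧ t.IsPositive) ∧
      ((∀ U, M ≠ lam U) → ∀ t : Ty, t.IsNegative → ∃ n Γ, M.Der n Γ t ∧ Γ.IsNegative) := by
  induction M with
  | var i =>
    exact ⟨⟨1, _, .base, ⟨rfl, rfl⟩, .single i .base, .base⟩,
      fun _ t ht => ⟨1, _, ⟨rfl, rfl⟩, .single i ht⟩⟩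
  | app U V ihU ihV =>
    have key : ∀ t : Ty, t.IsNegative → ∃ n Γ, (app U V).Der n Γ t ∧ Γ.IsNegative := by
      intro t ht
      obtain ⟨n, Γ, s, hV, hΓ, hs⟩ := (ihV fun p => hM (.arg :: p)).1
      -- The singleton list types the operand exactly once, which keeps the operator's type
      -- negative.
      obtain ⟨m, Δ, hU, hΔ⟩ := (ihU fun p => hM (.fn :: p)).2
        (fun W h => hM [] W V (by rw [h]; rfl)) (.arr [s] t) (.arr (by simp) (by simpa using hs) ht)
      exact ⟨_, _, ⟨m, n, Δ, Γ, [s], rfl, rfl, hU, .singleton hV⟩, hΔ.add hΓ⟩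
    refine ⟨?_, fun _ => key⟩
    obtain ⟨n, Γ, h, hΓ⟩ := key .base .base
    exact ⟨n, Γ, _, h, hΓ, .base⟩
  | lam U ih =>
    refine ⟨?_, fun h => absurd rfl (h U)⟩
    obtain ⟨n, Γ, t, hU, hΓ, ht⟩ := (ih fun p => hM (.body :: p)).1
    exact ⟨n + 1, Γ.tail, .arr (Γ 0).toList t,
      ⟨n, Γ, _, _, rfl, rfl, rfl, (Multiset.coe_toList _).symm, hU⟩, hΓ.tail,
      .arr (fun s hs => hΓ 0 s (Multiset.mem_toList.1 hs)) ht⟩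

theorem HasBetaNormalForm.exists_der {M : Term} (hM : M.HasBetaNormalForm) :
    ∃ n Γ t, M.Der n Γ t ∧ Γ.IsNegative ∧ t.IsPositive := by
  obtain ⟨N, hMN, hN⟩ := hM
  induction hMN using Relation.ReflTransGen.head_induction_on with
  | refl => exact hN.exists_der.1
  | head h _ ih =>
    obtain ⟨n, Γ, t, hder, hΓ, ht⟩ := ih
    obtain ⟨n', hder⟩ := hder.of_beta h
    exact ⟨n', Γ, t, hder, hΓ, ht⟩

/-! ### Leftmost linear reduction by recursion on terms -/

/-- Extend a map on variables under an abstraction. -/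
def consEnv (b : Bool) (e : ℕ → Bool) : ℕ → Bool
  | 0 => b
  | i + 1 => e i

/-- The leftmost linear variable occurrence of a term that is applied to `k` arguments, where `e`
tells which of the free variables are bound by generalized redexes. -/
def leftmost : Term → (ℕ → Bool) → ℕ → Option Pos
  | var i, e, _ => if e i = true then some [] else none
  | app U V, e, k =>
    match leftmost U e (k + 1) with
    | some p => some (Dir.fn :: p)
    | none => if headLambdas U = [] then (leftmost V e 0).map (Dir.arg :: ·) else none
  | lam U, e, k => (leftmost U (consEnv (decide (0 < k)) e) (k - 1)).map (Dir.body :: ·)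

/-- Where the generalized redex that is fired gets its argument, seen from a subterm: inside it,
from a free variable, or from one of the arguments that it is applied to. -/
inductive Source : Type
  | inner : Source
  | free (i : ℕ) : Source
  | stack (j : ℕ) : Source

/-- `Fire e k A σ M N`: the term `N` is obtained from `M`, applied to `k` arguments, by replacing
the leftmost linear variable occurrence by its argument, which is `A` unless `σ` is `inner`. -/
inductive Fire : (ℕ → Bool) → ℕ → Term → Source → Term → Term → Prop
  | var {e i} (k A) : e i = true → Fire e k A (.free i) (var i) A
  | lamInner {e k A U U'} : Fire (consEnv (decide (0 < k)) e) (k - 1) (shift 1 0 A) .inner U U' →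
      Fire e k A .inner (lam U) (lam U')
  | lamBound {e k A U U'} :
      Fire (consEnv (decide (0 < k)) e) (k - 1) (shift 1 0 A) (.free 0) U U' →
      Fire e k A (.stack 0) (lam U) (lam U')
  | lamFree {e k A i U U'} :
      Fire (consEnv (decide (0 < k)) e) (k - 1) (shift 1 0 A) (.free (i + 1)) U U' →
      Fire e k A (.free i) (lam U) (lam U')
  | lamStack {e k A j U U'} :
      Fire (consEnv (decide (0 < k)) e) (k - 1) (shift 1 0 A) (.stack j) U U' →
      Fire e k A (.stack (j + 1)) (lam U) (lam U')
  | fnInner {e k A U U'} (V) : Fire e (k + 1) A .inner U U' →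
      Fire e k A .inner (app U V) (app U' V)
  | fnFree {e k A i U U'} (V) : Fire e (k + 1) A (.free i) U U' →
      Fire e k A (.free i) (app U V) (app U' V)
  | fnStack {e k A j U U'} (V) : Fire e (k + 1) A (.stack (j + 1)) U U' →
      Fire e k A (.stack j) (app U V) (app U' V)
  | fire {e k U U'} (A V) : Fire e (k + 1) V (.stack 0) U U' →
      Fire e k A .inner (app U V) (app U' V)
  | argInner {e k A U V V'} : leftmost U e (k + 1) = none → headLambdas U = [] →
      Fire e 0 A .inner V V' → Fire e k A .inner (app U V) (app U V')
  | argFree {e k A i U V V'} : leftmost U e (k + 1) = none → headLambdas U = [] →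
      Fire e 0 A (.free i) V V' → Fire e k A (.free i) (app U V) (app U V')

/-! ### Leftmost linear reduction decreases the size of derivations -/

/-- The types of the variables that are not bound by generalized redexes are negative. -/
def NegativeOff (e : ℕ → Bool) (Γ : Ctx) : Prop :=
  ∀ i, e i = false → ∀ s ∈ Γ i, s.IsNegative

theorem NegativeOff.left {e : ℕ → Bool} {Γ Δ : Ctx} (h : NegativeOff e (Γ + Δ)) :
    NegativeOff e Γ := fun i hi s hs => h i hi s (Multiset.mem_add.2 (.inl hs))

theorem NegativeOff.right {e : ℕ → Bool} {Γ Δ : Ctx} (h : NegativeOff e (Γ + Δ)) :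
    NegativeOff e Δ := fun i hi s hs => h i hi s (Multiset.mem_add.2 (.inr hs))

/-- With no argument waiting, positivity of the arrow makes the types of the bound variable
negative. With one waiting, the variable belongs to a generalized redex and is exempt. -/
theorem NegativeOff.of_tail {e : ℕ → Bool} {Γ : Ctx} (h : NegativeOff e Γ.tail) {k : ℕ}
    {L : List Ty} {t : Ty} (h0 : Γ 0 = (L : Multiset Ty)) (ht : (Ty.arr L t).PositiveAfter k) :
    NegativeOff (consEnv (decide (0 < k)) e) Γ ∧ t.PositiveAfter (k - 1) := by
  cases k with
  | zero =>
    obtain _ | ⟨hL, ht⟩ := ht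
    refine ⟨?_, ht⟩
    rintro (_ | i) hi s hs
    · rw [h0] at hs
      exact hL s hs
    · exact h i hi s hs
  | succ k =>
    refine ⟨?_, ht⟩
    rintro (_ | i) hi s hs
    · simp [consEnv] at hi
    · exact h i hi s hs

theorem headLambdas_length_app (U V : Term) :
    (headLambdas (app U V)).length = (headLambdas U).length - 1 := by
  rw [headLambdas]
  cases headLambdas U <;> simp

/-- When the search finds nothing, the head variable is uninvolved, so its type is negative. Going
back up the spine, an application strips an arrow or cancels a head abstraction, and an abstraction
adds an arrow. -/
theorem Der.negativeAfter {M : Term} {e : ℕ → Bool} {k n : ℕ} {Γ : Ctx} {t : Ty}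
    (hM : leftmost M e k = none) (h : M.Der n Γ t) (hΓ : NegativeOff e Γ)
    (ht : t.PositiveAfter k) : t.NegativeAfter (headLambdas M).length := by
  induction M generalizing e k n Γ t with
  | var i =>
    obtain ⟨rfl, rfl⟩ := h
    have hi : e i = false := by simpa [leftmost] using hM
    exact hΓ i hi t (by simp)
  | app U V ihU _ =>
    obtain ⟨n₁, n₂, Γ₁, Γ₂, L, rfl, rfl, hU, hV⟩ := h
    have hU' : leftmost U e (k + 1) = none := by
      rw [leftmost] at hM
      split at hM
      · cases hM
      · assumption
    have := ihU hU' hU hΓ.left ht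
    rw [headLambdas_length_app]
    cases hl : (headLambdas U).length with
    | zero =>
      rw [hl] at this
      obtain _ | ⟨_, _, h⟩ := this
      exact h
    | succ l =>
      rw [hl] at this
      exact this
  | lam U ih =>
    obtain ⟨n, Γ, L, s, rfl, rfl, rfl, h0, hU⟩ := h
    obtain ⟨hΓ', ht'⟩ := hΓ.of_tail h0 ht
    have := ih (by simpa [leftmost] using hM) hU hΓ' ht'
    simpa [headLambdas, Ty.NegativeAfter] using this

/-- From a derivation of size `n` of `t` for some term in the context `Γ`, a smaller one for `N`
is obtained after moving derivations for `A` to it from the source of the argument. -/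
def Decreases (A N : Term) (n : ℕ) (Γ : Ctx) (t : Ty) : Source → Prop
  | .inner => ∃ n' < n, N.Der n' Γ t
  | .free i => ∃ L Γ₀, Γ = Γ₀ + Pi.single i L ∧
      ∀ m Δ, Many A.Der m Δ L → ∃ n' < n + m, N.Der n' (Γ₀ + Δ) t
  | .stack j => ∃ L t', Ty.TakeArg j L t t' ∧
      ∀ m Δ, Many A.Der m Δ L → ∃ n' < n + m, N.Der n' (Γ + Δ) t'

/-- While the argument lies outside the subterm, the claim is conditional: the subterm announces the
multiset `L` of types at which it needs `A`, and any derivations of these types, of total size `m`,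
may be plugged in. The enclosing redex then supplies them from its own argument derivations. -/
theorem Fire.decreases {e : ℕ → Bool} {k : ℕ} {A : Term} {σ : Source} {M N : Term}
    (hMN : Fire e k A σ M N) {n : ℕ} {Γ : Ctx} {t : Ty} (h : M.Der n Γ t)
    (hΓ : NegativeOff e Γ) (ht : t.PositiveAfter k) : Decreases A N n Γ t σ := by
  induction hMN generalizing n Γ t with
  | var k A hi =>
    obtain ⟨rfl, rfl⟩ := h
    -- The source of strictness: the axiom, of size `1`, is dropped, so `m < 1 + m`.
    refine ⟨{t}, 0, by simp, fun m Δ hA => ⟨m, by omega, ?_⟩⟩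
    rw [zero_add]
    exact hA.of_singleton
  | lamInner _ ih =>
    obtain ⟨n, Γ, L, s, rfl, rfl, rfl, h0, hU⟩ := h
    obtain ⟨hΓ', ht'⟩ := hΓ.of_tail h0 ht
    obtain ⟨n', hn, hU'⟩ := ih hU hΓ' ht'
    exact ⟨n' + 1, by omega, _, _, _, _, rfl, rfl, rfl, h0, hU'⟩
  | lamBound _ ih =>
    obtain ⟨n, Γ, K, s, rfl, rfl, rfl, h0, hU⟩ := h
    obtain ⟨hΓ', ht'⟩ := hΓ.of_tail h0 ht
    obtain ⟨L, Γ₀, rfl, hU'⟩ := ih hU hΓ' ht'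
    refine ⟨L, .arr (Γ₀ 0).toList s, .zero s ?_, fun m Δ hA => ?_⟩
    · rw [← h0, Multiset.coe_toList, add_comm]; simp
    · obtain ⟨n', hn, hd⟩ := hU' m (Ctx.lift 1 0 Δ)
        (hA.map _ (Ctx.lift_zero 1 0) (Ctx.lift_add 1 0) fun _ _ _ => Der.shift 1 0)
      refine ⟨n' + 1, by omega, _, _, _, _, rfl, ?_, rfl, ?_, hd⟩
      · simp [Ctx.tail_lift_succ]
      · simp [Ctx.lift_succ_zero_apply_zero]
  | lamFree _ ih =>
    obtain ⟨n, Γ, K, s, rfl, rfl, rfl, h0, hU⟩ := h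
    obtain ⟨hΓ', ht'⟩ := hΓ.of_tail h0 ht
    obtain ⟨L, Γ₀, rfl, hU'⟩ := ih hU hΓ' ht'
    refine ⟨L, Γ₀.tail, by simp, fun m Δ hA => ?_⟩
    obtain ⟨n', hn, hd⟩ := hU' m (Ctx.lift 1 0 Δ)
      (hA.map _ (Ctx.lift_zero 1 0) (Ctx.lift_add 1 0) fun _ _ _ => Der.shift 1 0)
    refine ⟨n' + 1, by omega, _, _, _, _, rfl, ?_, rfl, ?_, hd⟩
    · simp [Ctx.tail_lift_succ]
    · simpa [Ctx.lift_succ_zero_apply_zero] using h0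
  | lamStack _ ih =>
    obtain ⟨n, Γ, K, s, rfl, rfl, rfl, h0, hU⟩ := h
    obtain ⟨hΓ', ht'⟩ := hΓ.of_tail h0 ht
    obtain ⟨L, s', hs, hU'⟩ := ih hU hΓ' ht'
    refine ⟨L, .arr K s', .succ K hs, fun m Δ hA => ?_⟩
    obtain ⟨n', hn, hd⟩ := hU' m (Ctx.lift 1 0 Δ)
      (hA.map _ (Ctx.lift_zero 1 0) (Ctx.lift_add 1 0) fun _ _ _ => Der.shift 1 0)
    refine ⟨n' + 1, by omega, _, _, _, _, rfl, ?_, rfl, ?_, hd⟩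
    · simp [Ctx.tail_lift_succ]
    · simpa [Ctx.lift_succ_zero_apply_zero] using h0
  | fnInner V _ ih =>
    obtain ⟨n₁, n₂, Γ₁, Γ₂, L, rfl, rfl, hU, hV⟩ := h
    obtain ⟨n', hn, hU'⟩ := ih hU hΓ.left ht
    exact ⟨n' + n₂ + 1, by omega, _, _, _, _, L, rfl, rfl, hU', hV⟩
  | fnFree V _ ih =>
    obtain ⟨n₁, n₂, Γ₁, Γ₂, K, rfl, rfl, hU, hV⟩ := h
    obtain ⟨L, Γ₀, rfl, hU'⟩ := ih hU hΓ.left ht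
    refine ⟨L, Γ₀ + Γ₂, by abel, fun m Δ hA => ?_⟩
    obtain ⟨n', hn, hd⟩ := hU' m Δ hA
    exact ⟨n' + n₂ + 1, by omega, _, _, _, _, K, rfl, by abel, hd, hV⟩
  | fnStack V _ ih =>
    obtain ⟨n₁, n₂, Γ₁, Γ₂, K, rfl, rfl, hU, hV⟩ := h
    obtain ⟨L, _, _ | ⟨_, hs⟩, hU'⟩ := ih hU hΓ.left ht
    refine ⟨L, _, hs, fun m Δ hA => ?_⟩
    obtain ⟨n', hn, hd⟩ := hU' m Δ hA
    exact ⟨n' + n₂ + 1, by omega, _, _, _, _, K, rfl, by abel, hd, hV⟩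
  | fire A V _ ih =>
    obtain ⟨n₁, n₂, Γ₁, Γ₂, K, rfl, rfl, hU, hV⟩ := h
    obtain ⟨L, _, hs, hU'⟩ := ih hU hΓ.left ht
    cases hs with
    | @zero _ K' _ _ hK =>
    -- The redex is met: the derivations of `V` split into those of types `L`, moved to the
    -- occurrence, and the remaining ones, which still type the argument.
    rw [hK] at hV
    obtain ⟨m₁, m₂, Δ₁, Δ₂, rfl, rfl, hV₁, hV₂⟩ := hV.split
    obtain ⟨n', hn, hd⟩ := hU' _ _ hV₁
    exact ⟨n' + m₂ + 1, by omega, _, _, _, _, _, rfl, by abel, hd, hV₂⟩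
  | @argInner e k A U V V' hU₀ hl _ ih =>
    obtain ⟨n₁, n₂, Γ₁, Γ₂, K, rfl, rfl, hU, hV⟩ := h
    have hneg := hU.negativeAfter hU₀ hΓ.left ht
    rw [hl] at hneg
    obtain _ | ⟨hne, hpos, _⟩ := hneg
    -- Every copy of the operand's derivation shrinks; the total shrinks strictly because negativity
    -- of the operator's type makes `K` nonempty.
    have key : ∃ n', Many V'.Der n' Γ₂ K ∧ n' ≤ n₂ ∧ ((K : Multiset Ty) ≠ 0 → n' < n₂) := by
      have hΓ₂ := hΓ.right
      have hpos' : ∀ s ∈ (K : Multiset Ty), s.IsPositive := hpos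
      clear hΓ hU hpos hne
      generalize (K : Multiset Ty) = K at hV hpos'
      induction hV with
      | nil => exact ⟨0, .nil, le_rfl, by simp⟩
      | cons h _ ih' =>
        obtain ⟨n', hn, hd⟩ := ih h hΓ₂.left (hpos' _ (by simp))
        obtain ⟨m', hm, hle, _⟩ := ih' hΓ₂.right fun s hs => hpos' s (by simp [hs])
        exact ⟨_, .cons hd hm, by omega, fun _ => by omega⟩
    obtain ⟨n', hd, _, hlt⟩ := key
    have := hlt (by simpa using hne)
    exact ⟨n₁ + n' + 1, by omega, _, _, _, _, K, rfl, rfl, hU, hd⟩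
  | @argFree e k A i U V V' hU₀ hl _ ih =>
    obtain ⟨n₁, n₂, Γ₁, Γ₂, K, rfl, rfl, hU, hV⟩ := h
    have hneg := hU.negativeAfter hU₀ hΓ.left ht
    rw [hl] at hneg
    obtain _ | ⟨hne, hpos, _⟩ := hneg
    have key : ∃ L Γ₀, Γ₂ = Γ₀ + Pi.single i L ∧ ∀ m Δ, Many A.Der m Δ L →
        ∃ n', Many V'.Der n' (Γ₀ + Δ) K ∧ n' ≤ n₂ + m ∧
          ((K : Multiset Ty) ≠ 0 → n' < n₂ + m) := by
      have hΓ₂ := hΓ.right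
      have hpos' : ∀ s ∈ (K : Multiset Ty), s.IsPositive := hpos
      clear hΓ hU hpos hne
      generalize (K : Multiset Ty) = K at hV hpos'
      induction hV with
      | nil =>
        refine ⟨0, 0, by simp, fun m Δ hA => ?_⟩
        obtain ⟨rfl, rfl⟩ := hA.zero_inv
        exact ⟨0, by simpa using .nil, le_rfl, by simp⟩
      | cons h _ ih' =>
        obtain ⟨L₁, Θ₁, rfl, h₁⟩ := ih h hΓ₂.left (hpos' _ (by simp))
        obtain ⟨L₂, Θ₂, rfl, h₂⟩ := ih' hΓ₂.right fun s hs => hpos' s (by simp [hs])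
        -- Each copy of the operand's derivation types the fired occurrence separately, so the
        -- demands for `A` add up.
        refine ⟨L₁ + L₂, Θ₁ + Θ₂, by rw [Pi.single_add]; abel, fun m Δ hA => ?_⟩
        obtain ⟨m₁, m₂, Δ₁, Δ₂, rfl, rfl, hA₁, hA₂⟩ := hA.split
        obtain ⟨n', hn, hd⟩ := h₁ _ _ hA₁
        obtain ⟨m', hm, hle, _⟩ := h₂ _ _ hA₂
        refine ⟨n' + m', ?_, by omega, fun _ => by omega⟩
        rw [add_add_add_comm]
        exact .cons hd hm
    obtain ⟨L, Γ₀, rfl, hL⟩ := key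
    refine ⟨L, Γ₁ + Γ₀, by abel, fun m Δ hA => ?_⟩
    obtain ⟨n', hd, _, hlt⟩ := hL m Δ hA
    have := hlt (by simpa using hne)
    exact ⟨n₁ + n' + 1, by omega, _, _, _, _, K, rfl, by abel, hU, hd⟩

/-! ### Occurrences -/

theorem shift_shift_one (k c : ℕ) (A : Term) : shift k c (shift 1 c A) = shift (k + 1) c A := by
  induction A generalizing c with
  | var i =>
    by_cases h : i < c
    · simp [shift, h]
    · simp only [shift, h, if_false, if_neg (show ¬ i + 1 < c by omega)]
      congr 1; omega
  | app U V ihU ihV => simp [shift, ihU, ihV]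
  | lam U ih => simp [shift, ih]

theorem shift_zero (c : ℕ) (A : Term) : shift 0 c A = A := by
  induction A generalizing c with
  | var i => simp [shift]
  | app U V ihU ihV => simp [shift, ihU, ihV]
  | lam U ih => simp [shift, ih]

theorem Binds.cons_lam {U : Term} {q p : Pos} (h : Binds U q p) :
    Binds (lam U) (Dir.body :: q) (Dir.body :: p) := by
  obtain ⟨r, rfl, h⟩ := h
  exact ⟨r, rfl, h⟩

theorem Binds.cons_fn {U : Term} {q p : Pos} (h : Binds U q p) (V : Term) :
    Binds (app U V) (Dir.fn :: q) (Dir.fn :: p) := by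
  obtain ⟨r, rfl, h⟩ := h
  exact ⟨r, rfl, h⟩

theorem Binds.cons_arg {V : Term} {q p : Pos} (h : Binds V q p) (U : Term) :
    Binds (app U V) (Dir.arg :: q) (Dir.arg :: p) := by
  obtain ⟨r, rfl, h⟩ := h
  exact ⟨r, rfl, h⟩

/-- Two candidate binders lie on the same path; the outer one has the inner one strictly between
itself and the variable, so the abstraction counts differ. -/
theorem Binds.unique {M : Term} {p q q' : Pos} (h : Binds M q p) (h' : Binds M q' p) : q = q' := by
  obtain ⟨r, rfl, h⟩ := h
  obtain ⟨r', hr, h'⟩ := h'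
  have hc : r.count Dir.body = r'.count Dir.body := by
    rw [h] at h'
    simpa using h'
  obtain ⟨s, rfl, hs⟩ | ⟨s, rfl, hs⟩ := List.append_eq_append_iff.1 hr <;>
  · cases s with
    | nil => simp
    | cons d s =>
      obtain ⟨rfl, rfl⟩ : d = Dir.body ∧ _ = s ++ Dir.body :: _ := by simpa [eq_comm] using hs
      simp at hc
      omega

theorem headLambdas_app_getElem? (U V : Term) (j : ℕ) :
    (headLambdas (app U V))[j]? = (headLambdas U)[j + 1]?.map (Dir.fn :: ·) := by
  rw [headLambdas]
  cases headLambdas U <;> simp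

theorem fn_mem_headLambdas_app {U V : Term} {q : Pos} :
    q ∈ headLambdas (app U V) ↔ ∃ x ∈ (headLambdas U).tail, q = Dir.fn :: x := by
  rw [headLambdas]
  cases headLambdas U <;> simp [eq_comm]

theorem mem_genRedexes_lam {U : Term} {q a : Pos} :
    (q, a) ∈ genRedexes (lam U) ↔
      ∃ q' a', (q', a') ∈ genRedexes U ∧ q = Dir.body :: q' ∧ a = Dir.body :: a' := by
  simp [genRedexes, eq_comm]

theorem mem_genRedexes_app {U V : Term} {q a : Pos} :
    (q, a) ∈ genRedexes (app U V) ↔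
      (∃ x, (headLambdas U)[0]? = some x ∧ q = Dir.fn :: x ∧ a = [Dir.arg]) ∨
      (∃ q' a', (q', a') ∈ genRedexes U ∧ q = Dir.fn :: q' ∧ a = Dir.fn :: a') ∨
      (∃ q' a', (q', a') ∈ genRedexes V ∧ q = Dir.arg :: q' ∧ a = Dir.arg :: a') := by
  rw [genRedexes]
  cases headLambdas U <;> simp [eq_comm]

theorem headLambdas_nodup (M : Term) : (headLambdas M).Nodup := by
  induction M with
  | var i => simp [headLambdas]
  | app U V ihU _ =>
    rw [headLambdas]
    cases h : headLambdas U with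
    | nil => simp
    | cons x l =>
      rw [h] at ihU
      exact ihU.of_cons.map (List.cons_injective)
  | lam U ih => simpa [headLambdas] using ih.map (List.cons_injective)

/-- Head abstractions are those still waiting for an argument. Hence no abstraction is paired twice,
which gives `genRedexes_unique`. -/
theorem notMem_headLambdas_of_mem_genRedexes {M : Term} {q a : Pos} (h : (q, a) ∈ genRedexes M) :
    q ∉ headLambdas M := by
  induction M generalizing q a with
  | var i => simp [headLambdas]
  | app U V ihU _ =>
    rw [fn_mem_headLambdas_app]
    rintro ⟨x, hx, rfl⟩
    rcases mem_genRedexes_app.1 h with ⟨y, hy, hxy, -⟩ | ⟨q', a', h, hxy, -⟩ | ⟨q', a', h, hxy, -⟩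
    · obtain rfl : x = y := by simpa using hxy
      have := headLambdas_nodup U
      cases hl : headLambdas U <;> simp_all
    · obtain rfl : x = q' := by simpa using hxy
      exact ihU h (List.mem_of_mem_tail hx)
    · simp at hxy
  | lam U ih =>
    obtain ⟨q', a', h', rfl, -⟩ := mem_genRedexes_lam.1 h
    simpa [headLambdas] using ih h'

theorem genRedexes_unique {M : Term} {q a a' : Pos} (h : (q, a) ∈ genRedexes M)
    (h' : (q, a') ∈ genRedexes M) : a = a' := by
  induction M generalizing q a a' with
  | var i => simp [genRedexes] at h
  | app U V ihU ihV =>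
    rcases mem_genRedexes_app.1 h with
      ⟨x, hx, rfl, rfl⟩ | ⟨x, b, hx, rfl, rfl⟩ | ⟨x, b, hx, rfl, rfl⟩ <;>
    rcases mem_genRedexes_app.1 h' with
      ⟨y, hy, hxy, rfl⟩ | ⟨y, c, hy, hxy, rfl⟩ | ⟨y, c, hy, hxy, rfl⟩ <;>
    simp only [List.cons.injEq, reduceCtorEq, true_and, false_and] at hxy
    · rfl
    · subst hxy
      exact absurd (List.mem_of_getElem? hx) (notMem_headLambdas_of_mem_genRedexes hy)
    · subst hxy
      exact absurd (List.mem_of_getElem? hy) (notMem_headLambdas_of_mem_genRedexes hx)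
    · subst hxy
      rw [ihU hx hy]
    · subst hxy
      rw [ihV hx hy]
  | lam U ih =>
    obtain ⟨x, b, hx, rfl, rfl⟩ := mem_genRedexes_lam.1 h
    obtain ⟨y, c, hy, hxy, rfl⟩ := mem_genRedexes_lam.1 h'
    obtain rfl : x = y := by simpa using hxy
    rw [ih hx hy]

/-! ### Involved variable occurrences -/

/-- The abstraction at `q` of `M`, applied to `k` arguments, belongs to a generalized redex. -/
def Fired (k : ℕ) (M : Term) (q : Pos) : Prop :=
  q ∈ (headLambdas M).take k ∨ ∃ a, (q, a) ∈ genRedexes M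

theorem fired_lam_nil (k : ℕ) (U : Term) : Fired k (lam U) [] ↔ 0 < k := by
  cases k <;> simp [Fired, mem_genRedexes_lam, headLambdas]

theorem fired_lam_body (k : ℕ) (U : Term) (q : Pos) :
    Fired k (lam U) (Dir.body :: q) ↔ Fired (k - 1) U q := by
  cases k <;> simp [Fired, mem_genRedexes_lam, headLambdas, ← List.map_take]

theorem fired_app_fn (k : ℕ) (U V : Term) (q : Pos) :
    Fired k (app U V) (Dir.fn :: q) ↔ Fired (k + 1) U q := by
  have : Dir.fn :: q ∈ (headLambdas (app U V)).take k ∨ (headLambdas U)[0]? = some q ↔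
      q ∈ (headLambdas U).take (k + 1) := by
    rw [headLambdas]
    cases headLambdas U <;> simp [← List.map_take, eq_comm, or_comm]
  simp [Fired, mem_genRedexes_app, ← this, exists_or, or_assoc]

theorem fired_app_arg (k : ℕ) (U V : Term) (q : Pos) :
    Fired k (app U V) (Dir.arg :: q) ↔ Fired 0 V q := by
  have : Dir.arg :: q ∉ (headLambdas (app U V)).take k := fun h => by
    simpa using fn_mem_headLambdas_app.1 (List.mem_of_mem_take h)
  simp [Fired, mem_genRedexes_app, this]

/-- Involvement refers to the whole of `M`. The hypotheses say that `e` and `k` retain all of it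
that matters inside `N`, and the `fired_*` lemmas carry this to subterms. -/
theorem llocFrom_eq_leftmost (M N : Term) (p : Pos) (e : ℕ → Bool) (k : ℕ)
    (hfree : ∀ r i, N.subtermAt r = some (var (i + r.count Dir.body)) →
      (Involved M (p ++ r) ↔ e i = true))
    (hbound : ∀ q r, Binds N q r → (Involved M (p ++ r) ↔ Fired k N q)) :
    llocFrom M N p = (leftmost N e k).map (p ++ ·) := by
  induction N generalizing p e k with
  | var n =>
    have := hfree [] n rfl
    rw [List.append_nil] at this
    simp only [llocFrom, leftmost, this]
    split_ifs <;> simp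
  | app U V ihU ihV =>
    rw [llocFrom, leftmost, ihU (p ++ [Dir.fn]) e (k + 1), ihV (p ++ [Dir.arg]) e 0]
    · cases leftmost U e (k + 1) with
      | some q => simp
      | none =>
        cases leftmost V e 0 <;> simp
    · intro r i h
      simpa using hfree (Dir.arg :: r) i h
    · intro q r h
      simpa [fired_app_arg] using hbound _ _ (h.cons_arg U)
    · intro r i h
      simpa using hfree (Dir.fn :: r) i h
    · intro q r h
      simpa [fired_app_fn] using hbound _ _ (h.cons_fn V)
  | lam U ih =>
    rw [llocFrom, leftmost, ih (p ++ [Dir.body]) (consEnv (decide (0 < k)) e) (k - 1)]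
    · cases leftmost U (consEnv (decide (0 < k)) e) (k - 1) <;> simp
    · rintro r (_ | i) h
      · rw [zero_add] at h
        -- Index `0` of the body is bound by this very abstraction, which is fired exactly when an
        -- argument is waiting.
        simpa [fired_lam_nil, consEnv] using hbound [] (Dir.body :: r) ⟨r, rfl, h⟩
      · have := hfree (Dir.body :: r) i (by
          rw [List.count_cons_self, ← add_assoc, add_right_comm]; exact h)
        simpa [consEnv] using this
    · intro q r h
      simpa [fired_lam_body] using hbound _ _ h.cons_lam

theorem lloc_eq_leftmost (M : Term) : lloc M = leftmost M (fun _ => false) 0 := by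
  rw [lloc, llocFrom_eq_leftmost M M [] (fun _ => false) 0]
  · simp
  · rintro r i h
    simp only [List.nil_append, Bool.false_eq_true, iff_false]
    rintro ⟨_, _, s, rfl, h'⟩
    rw [h'] at h
    simp at h
    omega
  · intro q r h
    simp only [List.nil_append, Fired, List.take_zero, List.not_mem_nil, false_or]
    constructor
    · rintro ⟨⟨q', a⟩, hr, hb⟩
      obtain rfl := hb.unique h
      exact ⟨a, hr⟩
    · rintro ⟨a, ha⟩
      exact ⟨_, ha, h⟩

/-! ### Leftmost linear steps -/

/-- The alternatives follow the three sources. An argument from outside `N` crosses every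
abstraction of `N` above `p`, hence the full shift; an inner one crosses only those not already
above it. -/
theorem exists_fire {N : Term} {e : ℕ → Bool} {k : ℕ} {p : Pos} (h : leftmost N e k = some p) :
    (∃ i, e i = true ∧ N.subtermAt p = some (var (i + p.count Dir.body)) ∧
      ∀ A, Fire e k A (.free i) N (N.replaceAt p (shift (p.count Dir.body) 0 A))) ∨
    (∃ j q, j < k ∧ (headLambdas N)[j]? = some q ∧ Binds N q p ∧
      ∀ A, Fire e k A (.stack j) N (N.replaceAt p (shift (p.count Dir.body) 0 A))) ∨
    (∃ q a A, (q, a) ∈ genRedexes N ∧ Binds N q p ∧ N.subtermAt a = some A ∧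
      ∀ B, Fire e k B .inner N (N.linearSubst p a A)) := by
  induction N generalizing e k p with
  | var i =>
    left
    rw [leftmost] at h
    split_ifs at h with hi
    obtain rfl : [] = p := by simpa using h
    refine ⟨i, hi, rfl, fun A => ?_⟩
    have : replaceAt (var i) [] (shift (List.count Dir.body []) 0 A) = A := by
      simp [replaceAt, shift_zero]
    rw [this]
    exact .var k A hi
  | app U V ihU ihV =>
    rw [leftmost] at h
    split at h
    · rename_i p' hU
      obtain rfl : Dir.fn :: p' = p := by simpa using h
      obtain ⟨i, hi, hs, hf⟩ | ⟨_ | j, q, hj, hq, hb, hf⟩ | ⟨q, a, A, hr, hb, ha, hf⟩ := ihU hU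
      · exact .inl ⟨i, hi, hs, fun A => .fnFree V (hf A)⟩
      -- The first waiting argument is `V` itself. No abstraction of this application encloses it,
      -- so the difference of counts is again the full shift.
      · exact .inr (.inr ⟨_, [Dir.arg], V, mem_genRedexes_app.2 (.inl ⟨q, hq, rfl, rfl⟩),
          hb.cons_fn V, by simp [subtermAt], fun B => .fire B V (hf V)⟩)
      · exact .inr (.inl ⟨j, Dir.fn :: q, by omega, by rw [headLambdas_app_getElem?, hq]; rfl,
          hb.cons_fn V, fun A => .fnStack V (hf A)⟩)
      · exact .inr (.inr ⟨_, _, A, mem_genRedexes_app.2 (.inr (.inl ⟨q, a, hr, rfl, rfl⟩)),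
          hb.cons_fn V, ha, fun B => .fnInner V (hf B)⟩)
    · rename_i hU
      split_ifs at h with hl
      obtain ⟨p', hV, rfl⟩ := Option.map_eq_some_iff.1 h
      obtain ⟨i, hi, hs, hf⟩ | ⟨j, q, hj, -⟩ | ⟨q, a, A, hr, hb, ha, hf⟩ := ihV hV
      · exact .inl ⟨i, hi, hs, fun A => .argFree hU hl (hf A)⟩
      · omega
      · exact .inr (.inr ⟨_, _, A, mem_genRedexes_app.2 (.inr (.inr ⟨q, a, hr, rfl, rfl⟩)),
          hb.cons_arg U, ha, fun B => .argInner hU hl (hf B)⟩)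
  | lam U ih =>
    rw [leftmost] at h
    obtain ⟨p', hU, rfl⟩ := Option.map_eq_some_iff.1 h
    have key (A : Term) : (lam U).replaceAt (Dir.body :: p')
        (shift (List.count Dir.body (Dir.body :: p')) 0 A) =
        lam (U.replaceAt p' (shift (p'.count Dir.body) 0 (shift 1 0 A))) := by
      rw [shift_shift_one, List.count_cons_self]; rfl
    simp only [key]
    obtain ⟨_ | i, hi, hs, hf⟩ | ⟨j, q, hj, hq, hb, hf⟩ | ⟨q, a, A, hr, hb, ha, hf⟩ := ih hU
    · refine .inr (.inl ⟨0, [], by simpa [consEnv] using hi, rfl, ⟨p', rfl, ?_⟩,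
        fun A => .lamBound (hf _)⟩)
      rw [zero_add] at hs
      exact hs
    · refine .inl ⟨i, hi, ?_, fun A => .lamFree (hf _)⟩
      rw [List.count_cons_self, ← add_assoc, add_right_comm]
      exact hs
    · exact .inr (.inl ⟨j + 1, Dir.body :: q, by omega, by simp [headLambdas, hq], hb.cons_lam,
        fun A => .lamStack (hf _)⟩)
    · refine .inr (.inr ⟨_, _, A, mem_genRedexes_lam.2 ⟨q, a, hr, rfl, rfl⟩, hb.cons_lam, ha,
        fun B => ?_⟩)
      have : linearSubst (lam U) (Dir.body :: p') (Dir.body :: a) A =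
          lam (linearSubst U p' a A) := by
        simp [linearSubst, replaceAt]
      rw [this]
      exact .lamInner (hf _)

theorem exists_genRedex_of_lloc {M : Term} {p : Pos} (h : lloc M = some p) :
    ∃ q a A, (q, a) ∈ genRedexes M ∧ Binds M q p ∧ M.subtermAt a = some A ∧
      ∀ B, Fire (fun _ => false) 0 B .inner M (M.linearSubst p a A) := by
  rw [lloc_eq_leftmost] at h
  obtain ⟨i, hi, -⟩ | ⟨j, q, hj, -⟩ | h := exists_fire h
  · simp at hi
  · omega
  · exact h

-- Termination

theorem LeftmostLinear.der {M N : Term} (hMN : LeftmostLinear M N) {n : ℕ} {Γ : Ctx} {t : Ty}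
    (h : M.Der n Γ t) (hΓ : Γ.IsNegative) (ht : t.IsPositive) : ∃ n' < n, N.Der n' Γ t := by
  obtain ⟨p, q, a, A, hp, hr, hb, ha, rfl⟩ := hMN
  obtain ⟨q', a', A', hr', hb', ha', hf⟩ := exists_genRedex_of_lloc hp
  obtain rfl := hb.unique hb'
  obtain rfl := genRedexes_unique hr hr'
  obtain rfl : A = A' := by simpa [ha] using ha'
  exact (hf A).decreases h (fun i _ => hΓ i) ht

theorem exists_leftmostLinear {M : Term} (h : ¬ M.IsQuasiNormal) : ∃ N, LeftmostLinear M N := by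
  obtain ⟨p, hp⟩ := Option.ne_none_iff_exists'.1 h
  obtain ⟨q, a, A, hr, hb, ha, -⟩ := exists_genRedex_of_lloc hp
  exact ⟨_, p, q, a, A, hp, hr, hb, ha, rfl⟩

theorem Der.not_exists_infinite {n : ℕ} {Γ : Ctx} {t : Ty} (hΓ : Γ.IsNegative)
    (ht : t.IsPositive) (s : ℕ → Term) (h : (s 0).Der n Γ t)
    (hs : ∀ i, LeftmostLinear (s i) (s (i + 1))) : False := by
  induction n using Nat.strong_induction_on generalizing s with
  | h n ih =>
    obtain ⟨n', hn, h'⟩ := (hs 0).der h hΓ ht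
    exact ih n' hn (fun i => s (i + 1)) h' fun i => hs (i + 1)

theorem Der.exists_isQuasiNormal {n : ℕ} {Γ : Ctx} {t : Ty} (hΓ : Γ.IsNegative)
    (ht : t.IsPositive) {M : Term} (h : M.Der n Γ t) :
    ∃ N, Relation.ReflTransGen LeftmostLinear M N ∧ N.IsQuasiNormal := by
  induction n using Nat.strong_induction_on generalizing M with
  | h n ih =>
    by_cases hM : M.IsQuasiNormal
    · exact ⟨M, .refl, hM⟩
    · obtain ⟨M', hMM'⟩ := exists_leftmostLinear hM
      obtain ⟨n', hn, h'⟩ := hMM'.der h hΓ ht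
      obtain ⟨N, hN, hq⟩ := ih n' hn h'
      exact ⟨N, .head hMM' hN, hq⟩

end Term

end LambdaCalculus

theorem mainTheorem4 (M : LambdaCalculus.Term) (hM : M.HasBetaNormalForm) :
    (¬ ∃ s : ℕ → LambdaCalculus.Term,
        s 0 = M ∧ ∀ i : ℕ, LambdaCalculus.Term.LeftmostLinear (s i) (s (i + 1))) ∧
      ∃ N : LambdaCalculus.Term,
        Relation.ReflTransGen LambdaCalculus.Term.LeftmostLinear M N ∧ N.IsQuasiNormal := by
  obtain ⟨n, Γ, t, h, hΓ, ht⟩ := hM.exists_der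
  refine ⟨?_, h.exists_isQuasiNormal hΓ ht⟩
  rintro ⟨s, rfl, hs⟩
  exact h.not_exists_infinite hΓ ht s hs
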